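/- The terms $\mathcal T$ and substitutions $\mathcal S$ of the $\lambda\upsilon$-calculus (with de Bruijn indices $\mathcal N$ in unary notation) are given by the grammar $$\mathcal T ::= \mathcal N \mid \lambda\,\mathcal T \mid \mathcal T\,\mathcal T \mid \mathcal T[\mathcal S],\qquad \mathcal S ::= \mathcal T/ \mid {\Uparrow}(\mathcal S) \mid {\uparrow},\qquad \mathcal N ::= \underline{0} \mid \mathsf{succ}\,\mathcal N .$$ The size of a term is its total number of constructors, that is, $|\underline n| = n+1$, $|\lambda a| = 1+|a|$, $|ab| = 1+|a|+|b|$, $|a[s]| = 1+|a|+|s|$, $|a/| = 1+|a|$, $|{\Uparrow}(s)| = 1+|s|$, $|{\uparrow}| = 1$. For each $n\ge 1$ the set of terms of size $n$ is finite and non-empty. A constructor of a term $t$ is *suspended* (occurs under a closure) if it belongs to the substitution $s$ of some subterm $a[s]$ of $t$; the closure operator of $a[s]$ does not itself belong to $s$. For $n \ge 1$ let $t_n$ be a uniformly random term of size $n$, and let $X_n$ be the number of constructors of $t_n$ that are not suspended, so that $n - X_n$ is the number of suspended ones. Then $$\lim_{n\to\infty}\mathbb E(X_n) = \frac{316}{3}.$$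 Consequently, almost all of the content of a typical term is suspended under closures: $\mathbb E\bigl((n-X_n)/n\bigr) \to 1$, and for every $\varepsilon>0$, $\mathbb P\bigl(n-X_n \ge (1-\varepsilon)n\bigr)\to 1$ as $n\to\infty$. -/

import Mathlib

open Filter MeasureTheory ProbabilityTheory
open scoped Topology

namespace LambdaUpsilon

/-- De Bruijn indices in unary notation: `N ::= 0 | succ N`. -/
inductive Index : Type
  | zero : Index
  | succ : Index → Index

mutual
/-- Terms of the lambda-upsilon calculus: `T ::= N | λ T | T T | T [S]`. -/
inductive Term : Type
  | idx : Index → Term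
  | lam : Term → Term
  | app : Term → Term → Term
  | closure : Term → Subst → Term
/-- Explicit substitutions of the lambda-upsilon calculus: `S ::= T / | ⇑ (S) | ↑`. -/
inductive Subst : Type
  | slash : Term → Subst
  | lift : Subst → Subst
  | shift : Subst
end

/-- The size of an index: its number of constructors (zero and successors). -/
def Index.size : Index → ℕ
  | .zero => 1
  | .succ i => i.size + 1

mutual
/-- The size of a term: its total number of constructors, each of weight one. An index is itself
a term, so `Term.idx` is only an inclusion and has no weight. -/
def Term.size : Term → ℕ
  | .idx i => i.size
  | .lam a => a.size + 1
  | .app a b => a.size + b.size + 1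
  | .closure a s => a.size + s.size + 1
/-- The size of a substitution: its total number of constructors, each of weight one. -/
def Subst.size : Subst → ℕ
  | .slash a => a.size + 1
  | .lift s => s.size + 1
  | .shift => 1
end

/-- The number of constructors of a term which do not occur under a closure, that is, which are not
contained in any substitution `s` of a subterm `a[s]`. The closure operator of `a[s]` itself is not
part of `s`. -/
def Term.unsuspended : Term → ℕ
  | .idx i => i.size
  | .lam a => a.unsuspended + 1
  | .app a b => a.unsuspended + b.unsuspended + 1
  | .closure a _ => a.unsuspended + 1

/-- The number of constructors of a term which are suspended, that is, which occur in the
substitution `s` of some subterm `a[s]`. -/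
def Term.suspended : Term → ℕ
  | .idx _ => 0
  | .lam a => a.suspended
  | .app a b => a.suspended + b.suspended
  | .closure a s => a.suspended + s.size

theorem Term.unsuspended_add_suspended :
    ∀ t : Term, t.unsuspended + t.suspended = t.size
  | .idx i => by simp [Term.unsuspended, Term.suspended, Term.size]
  | .lam a => by
      have := Term.unsuspended_add_suspended a
      simp only [Term.unsuspended, Term.suspended, Term.size]; omega
  | .app a b => by
      have := Term.unsuspended_add_suspended a
      have := Term.unsuspended_add_suspended b
      simp only [Term.unsuspended, Term.suspended, Term.size]; omega
  | .closure a s => by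
      have := Term.unsuspended_add_suspended a
      simp only [Term.unsuspended, Term.suspended, Term.size]; omega

theorem Index.size_pos (i : Index) : 0 < i.size := by
  cases i <;> simp [Index.size]

theorem Term.size_pos (t : Term) : 0 < t.size := by
  cases t <;> simp [Term.size, Index.size_pos]

theorem finite_index_le (n : ℕ) : {i : Index | i.size ≤ n}.Finite := by
  induction n with
  | zero =>
    convert Set.finite_empty (α := Index)
    ext i
    simp [Nat.pos_iff_ne_zero.mp i.size_pos]
  | succ n ih =>
    refine ((Set.finite_singleton Index.zero).union (ih.image Index.succ)).subset ?_
    rintro (_ | i) hi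
    · simp
    · exact Or.inr ⟨i, by simpa [Index.size] using hi, rfl⟩

theorem finite_size_le (n : ℕ) :
    {t : Term | t.size ≤ n}.Finite ∧ {s : Subst | s.size ≤ n}.Finite := by
  induction n with
  | zero =>
    constructor
    · convert Set.finite_empty (α := Term)
      ext t
      simp [Nat.pos_iff_ne_zero.mp t.size_pos]
    · convert Set.finite_empty (α := Subst)
      ext s
      cases s <;> simp [Subst.size]
  | succ n ih =>
    obtain ⟨hT, hS⟩ := ih
    constructor
    · refine (((((finite_index_le (n + 1)).image Term.idx).union (hT.image Term.lam)).union
        (hT.image2 Term.app hT)).union (hT.image2 Term.closure hS)).subset ?_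
      rintro (i | a | ⟨a, b⟩ | ⟨a, s⟩) h <;> simp only [Set.mem_ofPred_eq, Term.size] at h
      · exact Or.inl (Or.inl (Or.inl ⟨i, h, rfl⟩))
      · exact Or.inl (Or.inl (Or.inr ⟨a, by simp only [Set.mem_ofPred_eq]; omega, rfl⟩))
      · exact Or.inl (Or.inr ⟨a, by simp only [Set.mem_ofPred_eq]; omega, b,
          by simp only [Set.mem_ofPred_eq]; omega, rfl⟩)
      · exact Or.inr ⟨a, by simp only [Set.mem_ofPred_eq]; omega, s,
          by simp only [Set.mem_ofPred_eq]; omega, rfl⟩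
    · refine (((hT.image Subst.slash).union (hS.image Subst.lift)).union
        (Set.finite_singleton Subst.shift)).subset ?_
      rintro (a | s | _) h
      · exact Or.inl (Or.inl ⟨a, by simpa [Subst.size] using h, rfl⟩)
      · exact Or.inl (Or.inr ⟨s, by simpa [Subst.size] using h, rfl⟩)
      · exact Or.inr rfl

/-- There are only finitely many terms of a given size. -/
theorem finite_size_eq (n : ℕ) : {t : Term | t.size = n}.Finite :=
  (finite_size_le n).1.subset fun _ h => le_of_eq h

/-- There is a term of every positive size. -/
theorem nonempty_size_eq {n : ℕ} (hn : 1 ≤ n) : {t : Term | t.size = n}.Nonempty := by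
  induction n, hn using Nat.le_induction with
  | base => exact ⟨.idx .zero, rfl⟩
  | succ n _ ih =>
    obtain ⟨t, ht⟩ := ih
    exact ⟨.lam t, congrArg (· + 1) ht⟩

instance : MeasurableSpace Term := ⊤

instance : DiscreteMeasurableSpace Term := ⟨fun _ => trivial⟩

/-- The law of a uniformly random term of size `n`: the uniform probability measure on the finite
set of terms of size `n`, which is nonempty for `n ≥ 1`. -/
noncomputable def uniformTerm (n : ℕ) : Measure Term :=
  uniformOn {t : Term | t.size = n}

theorem isProbabilityMeasure_uniformTerm {n : ℕ} (hn : 1 ≤ n) :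
    IsProbabilityMeasure (uniformTerm n) :=
  isProbabilityMeasure_uniformOn (finite_size_eq n) (nonempty_size_eq hn)

end LambdaUpsilon

/-! ### Renewal equations for subexponential weights -/

-- Let `T`, `S`, `U` be the generating functions of terms, of substitutions and of the total number
-- of unsuspended constructors, and `C` the Catalan series. Eliminating `S` from the grammar gives
-- `T = X (1 + T) ^ 2`, so `1 + T = C` (`one_add_termSeries`) and there are `catalan n` terms of
-- size `n ≥ 1`. A substitution contributes nothing to the unsuspended count, so the grammar makes
-- `U` satisfy a linear equation `U = H + K U`, with `H`, `K` explicit in `X`, `C` and the geometric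
-- series (`unsuspendedSeries_renewal`).
--
-- The value `K(1/4) = 15/16` lies below `1`, so the equation is a defective renewal equation, and
-- `catalan n / 4 ^ n` is a subexponential weight. In a convolution of such sequences only terms
-- with one small index matter. Hence, if `h n ~ η w n` and `g n ~ γ w n` with sums `H` and `G < 1`,
-- the solution of `d = h + g * d` satisfies `d n ~ L w n` with `L = η + γ H / (1 - G) + G L`
-- (`IsRenewal.tendsto_div`). This avoids singularity analysis.
--
-- Here `H = 5/6`, `η = 3/4`, `G = 15/16`, `γ = 7/16`, so `L = 16 (3/4 + (7/16)(40/3)) = 316/3`. A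
-- bounded mean makes the unsuspended fraction vanish in expectation, and Markov's inequality makes
-- it vanish in probability.

theorem Finset.sum_range_mul_eq_add_of_half {R : Type*} [CommSemiring R] (f g : ℕ → R) (n : ℕ) :
    ∑ k ∈ Finset.range (n + 1), f k * g (n - k) =
      ∑ k ∈ Finset.range (n / 2 + 1), f k * g (n - k) +
        ∑ k ∈ Finset.range (n - n / 2), g k * f (n - k) := by
  have h : n + 1 = n / 2 + 1 + (n - n / 2) := by omega
  conv_lhs => rw [h, Finset.sum_range_add]
  rw [← Finset.sum_range_reflect (fun k => g k * f (n - k))]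
  congr 1
  refine Finset.sum_congr rfl fun k hk => ?_
  rw [Finset.mem_range] at hk
  rw [mul_comm]
  congr 2 <;> omega

/-- A weight of subexponential type: consecutive ratios tend to one, and the value at `m` is
dominated by the value at `n` as long as `m ≤ n ≤ 2 * m`. -/
structure IsSubexpWeight (w : ℕ → ℝ) : Prop where
  pos : ∀ n, 0 < w n
  ratio : Tendsto (fun n => w (n + 1) / w n) atTop (𝓝 1)
  doubling : ∃ K, 0 ≤ K ∧ ∀ m n, m ≤ n → n ≤ 2 * m → w m ≤ K * w n

namespace IsSubexpWeight

variable {w : ℕ → ℝ}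

theorem tendsto_add_div (hw : IsSubexpWeight w) (k : ℕ) :
    Tendsto (fun n => w n / w (n + k)) atTop (𝓝 1) := by
  induction k with
  | zero => simp [div_self (hw.pos _).ne']
  | succ k ih =>
    have h := (hw.ratio.comp (tendsto_add_atTop_nat k)).inv₀ one_ne_zero
    have := ih.mul h
    simp only [inv_one, mul_one] at this
    refine this.congr fun n => ?_
    have h1 := (hw.pos (n + k)).ne'
    have h2 := (hw.pos (n + (k + 1))).ne'
    simp only [Function.comp, ← add_assoc] at *
    field_simp

theorem tendsto_sub_div (hw : IsSubexpWeight w) {g : ℕ → ℝ} {γ : ℝ}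
    (hg : Tendsto (fun n => g n / w n) atTop (𝓝 γ)) (k : ℕ) :
    Tendsto (fun n => g (n - k) / w n) atTop (𝓝 γ) := by
  rw [← tendsto_add_atTop_iff_nat k]
  have := hg.mul (hw.tendsto_add_div k)
  rw [mul_one] at this
  refine this.congr fun n => ?_
  rw [Nat.add_sub_cancel]
  have h1 := (hw.pos n).ne'
  field_simp

/-- Half of a convolution is asymptotically governed by the sum of its first factor. -/
theorem tendsto_half_convolution (hw : IsSubexpWeight w) {f g : ℕ → ℝ} {γ : ℝ}
    (hf : Summable f) (hg : Tendsto (fun n => g n / w n) atTop (𝓝 γ)) {N : ℕ → ℕ}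
    (hN : Tendsto N atTop atTop) (hN' : ∀ n, N n ≤ n / 2 + 1) :
    Tendsto (fun n => (∑ k ∈ Finset.range (N n), f k * g (n - k)) / w n) atTop
      (𝓝 (γ * ∑' k, f k)) := by
  obtain ⟨K, hK0, hK⟩ := hw.doubling
  obtain ⟨B, hB⟩ := hg.abs.bddAbove_range
  have hB' : ∀ n, |g n| ≤ B * w n := fun n => by
    have : |g n / w n| ≤ B := hB ⟨n, rfl⟩
    rwa [abs_div, abs_of_pos (hw.pos n), div_le_iff₀ (hw.pos n)] at this
  have hB0 : 0 ≤ B := (abs_nonneg _).trans (hB ⟨0, rfl⟩)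
  have key := tendsto_tsum_of_dominated_convergence (𝓕 := atTop)
    (f := fun n k => if k < N n then f k * (g (n - k) / w n) else 0)
    (g := fun k => f k * γ) (bound := fun k => |f k| * (B * K)) (hf.abs.mul_right _)
    (fun k => ?_) (Eventually.of_forall fun n k => ?_)
  · rw [tsum_mul_right, mul_comm] at key
    refine key.congr fun n => ?_
    rw [tsum_eq_sum (s := Finset.range (N n)) (fun k hk => by simp_all), Finset.sum_div]
    refine Finset.sum_congr rfl fun k hk => ?_
    rw [if_pos (Finset.mem_range.mp hk), mul_div_assoc]
  · refine ((hw.tendsto_sub_div hg k).const_mul (f k)).congr' ?_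
    filter_upwards [hN.eventually_gt_atTop k] with n hn
    rw [if_pos hn]
  · split_ifs with hk
    · rw [Real.norm_eq_abs, abs_mul, abs_div, abs_of_pos (hw.pos n)]
      refine mul_le_mul_of_nonneg_left ?_ (abs_nonneg _)
      rw [div_le_iff₀ (hw.pos n), mul_assoc]
      have := hN' n
      -- Since `k ≤ n / 2`, we have `n - k ≤ n ≤ 2 * (n - k)`, the range in which doubling applies.
      exact (hB' _).trans (mul_le_mul_of_nonneg_left (hK _ _ (by omega) (by omega)) hB0)
    · rw [norm_zero]; positivity

end IsSubexpWeight

/-- The hypotheses of a renewal equation `d = h + g * d` (convolution) with defect. -/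
structure IsRenewal (d h g : ℕ → ℝ) : Prop where
  d_nonneg : ∀ n, 0 ≤ d n
  g_nonneg : ∀ n, 0 ≤ g n
  g_zero : g 0 = 0
  eqn : ∀ n, d n = h n + ∑ k ∈ Finset.range (n + 1), g k * d (n - k)

namespace IsRenewal

variable {w d h g : ℕ → ℝ} {H G η γ : ℝ}

/-- Partial sums `D` of `d` satisfy `D ≤ ∑ |h| + G * D`, because the truncated convolution is at
most the product of the partial sums; as `G < 1`, this bounds `D`. -/
theorem summable (hr : IsRenewal d h g) (hh : Summable h) (hg : HasSum g G) (hG : G < 1) :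
    Summable d := by
  refine summable_of_sum_range_le (c := (∑' n, |h n|) / (1 - G)) hr.d_nonneg fun N => ?_
  rw [le_div_iff₀ (by linarith)]
  have h1 : ∑ n ∈ Finset.range N, h n ≤ ∑' n, |h n| :=
    (Finset.sum_le_sum fun n _ => le_abs_self (h n)).trans
      (hh.abs.sum_le_tsum _ fun n _ => abs_nonneg _)
  have h2 : ∑ n ∈ Finset.range N, ∑ k ∈ Finset.range (n + 1), g k * d (n - k) ≤
      G * ∑ n ∈ Finset.range N, d n := by
    calc _ ≤ (∑ k ∈ Finset.range N, g k) * ∑ n ∈ Finset.range N, d n := by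
          rw [Finset.sum_range_diag_flip N fun k m => g k * d m, Finset.sum_mul_sum]
          refine Finset.sum_le_sum fun m _ => Finset.sum_le_sum_of_subset_of_nonneg
            (Finset.range_subset_range.mpr (Nat.sub_le N m)) fun k _ _ => ?_
          exact mul_nonneg (hr.g_nonneg m) (hr.d_nonneg k)
      _ ≤ _ := mul_le_mul_of_nonneg_right
          (sum_le_hasSum _ (fun n _ => hr.g_nonneg n) hg)
          (Finset.sum_nonneg fun n _ => hr.d_nonneg n)
  have h3 : ∑ n ∈ Finset.range N, d n = ∑ n ∈ Finset.range N, h n +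
      ∑ n ∈ Finset.range N, ∑ k ∈ Finset.range (n + 1), g k * d (n - k) := by
    rw [← Finset.sum_add_distrib]
    exact Finset.sum_congr rfl fun n _ => hr.eqn n
  linarith

theorem tsum_eq (hr : IsRenewal d h g) (hh : HasSum h H) (hg : HasSum g G) (hG : G < 1) :
    ∑' n, d n = H / (1 - G) := by
  have hd := hr.summable hh.summable hg hG
  have h1 := hh.add (hasSum_sum_range_mul_of_summable_norm hg.summable.norm hd.norm)
  have h2 := (h1.congr_fun hr.eqn).unique hd.hasSum
  rw [hg.tsum_eq] at h2
  have h3 : 1 - G ≠ 0 := by linarith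
  rw [eq_div_iff h3]
  linarith

/-- The terms of the convolution in which `d` has a small index, together with `h`. -/
theorem tendsto_remainder (hw : IsSubexpWeight w) (hr : IsRenewal d h g) (hh : HasSum h H)
    (hg : HasSum g G) (hG : G < 1) (hη : Tendsto (fun n => h n / w n) atTop (𝓝 η))
    (hγ : Tendsto (fun n => g n / w n) atTop (𝓝 γ)) :
    Tendsto (fun n => h n / w n +
      (∑ k ∈ Finset.range (n - n / 2), d k * g (n - k)) / w n) atTop
      (𝓝 (η + γ * (H / (1 - G)))) := by
  rw [← hr.tsum_eq hh hg hG]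
  refine hη.add (hw.tendsto_half_convolution (hr.summable hh.summable hg hG) hγ ?_
    fun n => by omega)
  exact tendsto_atTop_atTop.mpr fun b => ⟨2 * b, fun n hn => by omega⟩

theorem tendsto_mass (hw : IsSubexpWeight w) (hg : HasSum g G) :
    Tendsto (fun n => (∑ k ∈ Finset.range (n / 2 + 1), g k * w (n - k)) / w n) atTop (𝓝 G) := by
  have := hw.tendsto_half_convolution (g := w) (γ := 1) (N := fun n => n / 2 + 1) hg.summable
    (by simp [div_self (hw.pos _).ne'])
    (tendsto_atTop_atTop.mpr fun b => ⟨2 * b, fun n hn => by omega⟩) fun n => le_rfl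
  rwa [hg.tsum_eq, one_mul] at this

/-- The terms with a small index on `d` join `h` in a remainder already known to be asymptotic to a
multiple of `w`. What is left involves `d` only at indices at least `n / 2`, where an induction
hypothesis or an eventual bound can be used. -/
theorem eq_remainder_add (hw : IsSubexpWeight w) (hr : IsRenewal d h g) (n : ℕ) :
    d n = w n * (h n / w n + (∑ k ∈ Finset.range (n - n / 2), d k * g (n - k)) / w n) +
      ∑ k ∈ Finset.range (n / 2 + 1), g k * d (n - k) := by
  have h1 := (hw.pos n).ne'
  rw [hr.eqn n, Finset.sum_range_mul_eq_add_of_half]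
  field_simp
  ring

theorem exists_le (hw : IsSubexpWeight w) (hr : IsRenewal d h g) (hh : HasSum h H)
    (hg : HasSum g G) (hG : G < 1) (hη : Tendsto (fun n => h n / w n) atTop (𝓝 η))
    (hγ : Tendsto (fun n => g n / w n) atTop (𝓝 γ)) : ∃ M, ∀ n, d n ≤ M * w n := by
  have hE := hr.tendsto_remainder hw hh hg hG hη hγ
  have hP := tendsto_mass hw hg
  obtain ⟨θ, hGθ, hθ⟩ := exists_between hG
  set E := η + γ * (H / (1 - G))
  have hA : E < |E| + 1 := (le_abs_self E).trans_lt (lt_add_one _)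
  obtain ⟨N, hN⟩ := eventually_atTop.mp
    ((hE.eventually_lt_const hA).and (hP.eventually_lt_const hGθ))
  have hθ' : 0 < 1 - θ := by linarith
  set A := |E| + 1
  have hA0 : 0 < A := by positivity
  set S := ∑ m ∈ Finset.range N, d m / w m
  have hS : 0 ≤ S := Finset.sum_nonneg fun m _ => div_nonneg (hr.d_nonneg m) (hw.pos m).le
  refine ⟨S + A / (1 - θ), fun n => ?_⟩
  induction n using Nat.strong_induction_on with
  | _ n ih =>
    -- `S` covers the indices below `N`; from `N` on, the summand `A / (1 - θ)` ensures `A + θ * M ≤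
    -- M`, which closes the induction.
    set M := S + A / (1 - θ) with hM
    have hM0 : 0 ≤ M := by positivity
    have hwn := hw.pos n
    rcases lt_or_ge n N with hn | hn
    · rw [← div_le_iff₀ hwn]
      have : d n / w n ≤ S := Finset.single_le_sum (f := fun m => d m / w m)
        (fun m _ => div_nonneg (hr.d_nonneg m) (hw.pos m).le) (Finset.mem_range.mpr hn)
      have : 0 ≤ A / (1 - θ) := by positivity
      linarith
    · obtain ⟨h1, h2⟩ := hN n hn
      have h3 : ∑ k ∈ Finset.range (n / 2 + 1), g k * d (n - k) ≤
          M * ∑ k ∈ Finset.range (n / 2 + 1), g k * w (n - k) := by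
        rw [Finset.mul_sum]
        refine Finset.sum_le_sum fun k hk => ?_
        rw [Finset.mem_range] at hk
        -- `g 0 = 0` removes the one term to which the induction hypothesis does not apply.
        rcases Nat.eq_zero_or_pos k with rfl | hk0
        · simp [hr.g_zero]
        · calc _ ≤ g k * (M * w (n - k)) :=
                mul_le_mul_of_nonneg_left (ih _ (by omega)) (hr.g_nonneg k)
            _ = _ := by ring
      rw [div_lt_iff₀ hwn] at h2
      have h4 : A ≤ M * (1 - θ) := by
        rw [← div_le_iff₀ hθ']; linarith
      rw [hr.eq_remainder_add hw n]
      calc _ ≤ w n * A + M * (θ * w n) := by gcongr; exact h3.trans (by gcongr)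
        _ ≤ M * w n := by nlinarith

/-- Iterated contraction: a sequence of nonnegative terms that is bounded and whose eventual bounds
improve by a constant factor tends to zero. -/
theorem _root_.tendsto_zero_of_eventually_le_mul {s : ℕ → ℝ} {θ M : ℝ} (hθ0 : 0 < θ) (hθ : θ < 1)
    (hM : 0 < M) (hs0 : ∀ n, 0 ≤ s n) (hs : ∀ n, s n ≤ M)
    (h : ∀ B, 0 < B → (∀ᶠ n in atTop, s n ≤ B) → ∀ᶠ n in atTop, s n ≤ θ * B) :
    Tendsto s atTop (𝓝 0) := by
  have h1 : ∀ j : ℕ, ∀ᶠ n in atTop, s n ≤ θ ^ j * M := fun j => by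
    induction j with
    | zero => exact Eventually.of_forall fun n => by simpa using hs n
    | succ j ih =>
      rw [pow_succ', mul_assoc]
      exact h _ (by positivity) ih
  refine tendsto_order.mpr ⟨fun a ha => Eventually.of_forall fun n => ha.trans_le (hs0 n),
    fun a ha => ?_⟩
  have h2 := (tendsto_pow_atTop_nhds_zero_of_lt_one hθ0.le hθ).mul_const M
  rw [zero_mul] at h2
  obtain ⟨j, hj⟩ := (h2.eventually_lt_const ha).exists
  exact (h1 j).mono fun n hn => hn.trans_lt hj

/-- The asymptotic behaviour of the solution of a defective renewal equation. -/
theorem tendsto_div (hw : IsSubexpWeight w) (hr : IsRenewal d h g) (hh : HasSum h H)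
    (hg : HasSum g G) (hG : G < 1) (hη : Tendsto (fun n => h n / w n) atTop (𝓝 η))
    (hγ : Tendsto (fun n => g n / w n) atTop (𝓝 γ)) :
    Tendsto (fun n => d n / w n) atTop (𝓝 ((η + γ * (H / (1 - G))) / (1 - G))) := by
  have hE := hr.tendsto_remainder hw hh hg hG hη hγ
  have hP := tendsto_mass hw hg
  obtain ⟨M, hM⟩ := hr.exists_le hw hh hg hG hη hγ
  set E := η + γ * (H / (1 - G))
  set L := E / (1 - G) with hL
  -- `L` is the fixed point of the limiting recursion; subtracting this identity leaves a recursion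
  -- for `d n - L * w n` that contracts by about `G`.
  have hLE : L = E + G * L := by
    have : 1 - G ≠ 0 := by linarith
    rw [hL]; field_simp; ring
  have hG0 : 0 ≤ G := hg.nonneg hr.g_nonneg
  obtain ⟨θ, hGθ, hθ⟩ := exists_between hG
  have hM0 : 0 ≤ M := nonneg_of_mul_nonneg_left ((hr.d_nonneg 0).trans (hM 0)) (hw.pos 0)
  have hd : ∀ n, |d n / w n - L| = |d n - L * w n| / w n := fun n => by
    rw [← abs_of_pos (hw.pos n), ← abs_div, abs_of_pos (hw.pos n), sub_div,
      mul_div_cancel_right₀ _ (hw.pos n).ne']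
  rw [tendsto_iff_norm_sub_tendsto_zero]
  simp only [Real.norm_eq_abs]
  refine tendsto_zero_of_eventually_le_mul (hG0.trans_lt hGθ) hθ
    (M := M + |L| + 1) (by positivity) (fun n => abs_nonneg _) (fun n => ?_) fun B hB hs => ?_
  · have h1 : |d n / w n| ≤ M := by
      rw [abs_of_nonneg (div_nonneg (hr.d_nonneg n) (hw.pos n).le), div_le_iff₀ (hw.pos n)]
      exact hM n
    linarith [abs_sub (d n / w n) L]
  · obtain ⟨N, hN⟩ := eventually_atTop.mp hs
    have hε := ((hE.sub_const E).abs.add ((hP.sub_const G).abs.const_mul |L|)).add (hP.mul_const B)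
    simp only [sub_self, abs_zero, mul_zero, zero_add] at hε
    have hlt : G * B < θ * B := by gcongr
    -- With `n ≥ 2 * N`, every index `n - k` with `k ≤ n / 2` is at least `N`, so the current bound
    -- `B` holds there. The remaining errors tend to zero and fit into the gap between `G * B` and
    -- `θ * B`.
    filter_upwards [hε.eventually_lt_const hlt, eventually_ge_atTop (2 * N)] with n hn hnN
    have hwn := hw.pos n
    rw [hd, div_le_iff₀ hwn]
    refine le_trans ?_ (mul_le_mul_of_nonneg_right hn.le hwn.le)
    have hdn := hr.eq_remainder_add hw n
    set e := h n / w n + (∑ k ∈ Finset.range (n - n / 2), d k * g (n - k)) / w n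
    set P := ∑ k ∈ Finset.range (n / 2 + 1), g k * w (n - k) with hPdef
    have h1 : |∑ k ∈ Finset.range (n / 2 + 1), g k * (d (n - k) - L * w (n - k))| ≤ B * P := by
      rw [hPdef, Finset.mul_sum]
      refine (Finset.abs_sum_le_sum_abs _ _).trans (Finset.sum_le_sum fun k hk => ?_)
      rw [Finset.mem_range] at hk
      have h2 := hN (n - k) (by omega)
      rw [hd, div_le_iff₀ (hw.pos _)] at h2
      rw [abs_mul, abs_of_nonneg (hr.g_nonneg k)]
      calc _ ≤ g k * (B * w (n - k)) := mul_le_mul_of_nonneg_left h2 (hr.g_nonneg k)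
        _ = _ := by ring
    have h3 : d n - L * w n = w n * (e - E) + L * (w n * (P / w n - G)) +
        ∑ k ∈ Finset.range (n / 2 + 1), g k * (d (n - k) - L * w (n - k)) := by
      have h4 : ∑ k ∈ Finset.range (n / 2 + 1), g k * (d (n - k) - L * w (n - k)) =
          ∑ k ∈ Finset.range (n / 2 + 1), g k * d (n - k) - L * P := by
        rw [hPdef, Finset.mul_sum, ← Finset.sum_sub_distrib]
        exact Finset.sum_congr rfl fun k _ => by ring
      rw [h4, mul_sub (w n) (P / w n), mul_div_cancel₀ _ hwn.ne']
      linear_combination hdn - w n * hLE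
    have h5 : P / w n * B * w n = B * P := by field_simp
    calc |d n - L * w n| ≤ |w n * (e - E)| + |L * (w n * (P / w n - G))| + B * P := by
          rw [h3]
          exact (abs_add_le _ _).trans (add_le_add (abs_add_le _ _) h1)
      _ = _ := by
          rw [abs_mul, abs_mul, abs_mul, abs_of_pos hwn, add_mul, h5]; ring

end IsRenewal

/-! ### Catalan numbers as a weight -/

theorem catalan_succ_mul (n : ℕ) : (n + 2) * catalan (n + 1) = 2 * (2 * n + 1) * catalan n := by
  have h1 := succ_mul_catalan_eq_centralBinom n
  have h2 := succ_mul_catalan_eq_centralBinom (n + 1)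
  have h3 := Nat.succ_mul_centralBinom_succ n
  rw [← h1, ← h2] at h3
  refine Nat.eq_of_mul_eq_mul_left (Nat.add_one_pos n) ?_
  calc _ = (n + 1) * ((n + 1 + 1) * catalan (n + 1)) := by ring
    _ = _ := by rw [h3]; ring

theorem catalan_pos (n : ℕ) : 0 < catalan n := by
  refine Nat.pos_of_ne_zero fun h => n.centralBinom_pos.ne' ?_
  rw [← succ_mul_catalan_eq_centralBinom, h, mul_zero]

/-- The Catalan numbers, normalised by their exponential growth rate. -/
noncomputable def catalanWeight (n : ℕ) : ℝ := catalan n / 4 ^ n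

theorem catalanWeight_pos (n : ℕ) : 0 < catalanWeight n :=
  div_pos (Nat.cast_pos.mpr (catalan_pos n)) (by positivity)

theorem catalanWeight_succ (n : ℕ) :
    catalanWeight (n + 1) = (2 * n + 1) / (2 * (n + 2)) * catalanWeight n := by
  have h : ((n : ℝ) + 2) * catalan (n + 1) = 2 * (2 * n + 1) * catalan n := by
    exact_mod_cast catalan_succ_mul n
  rw [catalanWeight, catalanWeight, pow_succ]
  field_simp
  linarith

theorem tendsto_catalanWeight_ratio :
    Tendsto (fun n => catalanWeight (n + 1) / catalanWeight n) atTop (𝓝 1) := by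
  have h : Tendsto (fun n : ℕ => 1 - (3 / 2 : ℝ) * (1 / ((n + 2 : ℕ) : ℝ))) atTop (𝓝 1) := by
    have := (tendsto_one_div_atTop_nhds_zero_nat (𝕜 := ℝ)).comp (tendsto_add_atTop_nat 2)
    simpa using (this.const_mul (3 / 2 : ℝ)).const_sub 1
  refine h.congr fun n => ?_
  rw [catalanWeight_succ, mul_div_cancel_right₀ _ (catalanWeight_pos n).ne']
  push_cast
  field_simp
  ring

/-- The true decay is of order `n ^ (-3 / 2)`. Exponent `2` leaves enough room for an elementary
ratio comparison, and it yields both the doubling property and a polynomial lower bound on the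
weight. -/
theorem monotone_sq_mul_catalanWeight :
    Monotone fun n : ℕ => ((n : ℝ) + 1) ^ 2 * catalanWeight n := by
  refine monotone_nat_of_le_succ fun n => ?_
  have h : ((n : ℝ) + 1) ^ 2 ≤ ((n : ℝ) + 2) ^ 2 * ((2 * n + 1) / (2 * (n + 2))) := by
    rw [mul_div_assoc', le_div_iff₀ (by positivity)]
    have : (0 : ℝ) ≤ n := n.cast_nonneg
    nlinarith [mul_nonneg this this]
  calc _ ≤ _ := mul_le_mul_of_nonneg_right h (catalanWeight_pos n).le
    _ = _ := by rw [catalanWeight_succ]; push_cast; ring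

theorem isSubexpWeight_catalanWeight : IsSubexpWeight catalanWeight where
  pos := catalanWeight_pos
  ratio := tendsto_catalanWeight_ratio
  doubling := by
    refine ⟨4, by norm_num, fun m n hmn hnm => ?_⟩
    have h1 : ((m : ℝ) + 1) ^ 2 * catalanWeight m ≤ ((n : ℝ) + 1) ^ 2 * catalanWeight n :=
      monotone_sq_mul_catalanWeight hmn
    have h2 : (n : ℝ) ≤ 2 * m := by exact_mod_cast hnm
    have h3 : ((n : ℝ) + 1) ^ 2 ≤ 4 * ((m : ℝ) + 1) ^ 2 := by
      have : (0 : ℝ) ≤ n := n.cast_nonneg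
      nlinarith
    have h4 : ((m : ℝ) + 1) ^ 2 * catalanWeight m ≤
        ((m : ℝ) + 1) ^ 2 * (4 * catalanWeight n) := by
      refine h1.trans ?_
      have := mul_le_mul_of_nonneg_right h3 (catalanWeight_pos n).le
      linarith
    exact le_of_mul_le_mul_left h4 (by positivity)

/-- The sum telescopes. Only its boundedness by `2` is needed, to get summability. -/
theorem sum_range_catalanWeight (N : ℕ) :
    ∑ n ∈ Finset.range N, catalanWeight n = 2 - 2 * (N + 1) * catalanWeight N := by
  induction N with
  | zero => simp [catalanWeight]
  | succ N ih =>
    rw [Finset.sum_range_succ, ih, catalanWeight_succ]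
    push_cast
    field_simp
    ring

theorem summable_catalanWeight : Summable catalanWeight := by
  refine summable_of_sum_range_le (c := 2) (fun n => (catalanWeight_pos n).le) fun N => ?_
  have := catalanWeight_pos N
  rw [sum_range_catalanWeight]
  nlinarith [mul_nonneg (N.cast_nonneg (α := ℝ)) this.le]

theorem catalanWeight_succ_eq_sum (n : ℕ) : catalanWeight (n + 1) =
    (∑ k ∈ Finset.range (n + 1), catalanWeight k * catalanWeight (n - k)) / 4 := by
  rw [catalanWeight, catalan_succ',
    Finset.Nat.sum_antidiagonal_eq_sum_range_succ fun i j => catalan i * catalan j]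
  push_cast
  rw [Finset.sum_div, Finset.sum_div]
  refine Finset.sum_congr rfl fun k hk => ?_
  have h : (4 : ℝ) ^ (n + 1) = 4 ^ k * 4 ^ (n - k) * 4 := by
    rw [pow_succ, ← pow_add, Nat.add_sub_cancel' (Finset.mem_range_succ_iff.mp hk)]
  rw [catalanWeight, catalanWeight, h]
  field_simp

/-- At `1 / 4` the Catalan equation reads `s = 1 + s ^ 2 / 4`, which has the double root `2`. -/
theorem hasSum_catalanWeight : HasSum catalanWeight 2 := by
  have hs := summable_catalanWeight
  have h1 := hs.tsum_eq_zero_add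
  have h2 := tsum_mul_tsum_eq_tsum_sum_range_of_summable_norm hs.norm hs.norm
  simp only [catalanWeight_succ_eq_sum] at h1
  rw [tsum_div_const, ← h2, catalanWeight, catalan_zero] at h1
  have h3 : (∑' n, catalanWeight n - 2) ^ 2 = 0 := by
    norm_num at h1
    linarith
  rw [← sub_eq_zero.mp (pow_eq_zero_iff two_ne_zero |>.mp h3)]
  exact hs.hasSum

/-! ### Power series comparable to the Catalan series -/

open PowerSeries

/-- The sequence of coefficients of `A`, normalised by `4 ^ n`. -/
noncomputable def PowerSeries.normCoeff (A : PowerSeries ℝ) (n : ℕ) : ℝ := coeff n A / 4 ^ n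

/-- The power series `A` converges at `1 / 4` to `a`, and its coefficients are asymptotically `α`
times the Catalan numbers. -/
structure PowerSeries.CatalanLike (A : PowerSeries ℝ) (a α : ℝ) : Prop where
  hasSum : HasSum A.normCoeff a
  tendsto : Tendsto (fun n => A.normCoeff n / catalanWeight n) atTop (𝓝 α)

namespace PowerSeries.CatalanLike

variable {A B : PowerSeries ℝ} {a b α β : ℝ}

theorem add (hA : A.CatalanLike a α) (hB : B.CatalanLike b β) :
    (A + B).CatalanLike (a + b) (α + β) where
  hasSum := (hA.hasSum.add hB.hasSum).congr_fun fun n => by simp [normCoeff, add_div]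
  tendsto := (hA.tendsto.add hB.tendsto).congr fun n => by simp [normCoeff, add_div]

theorem sub (hA : A.CatalanLike a α) (hB : B.CatalanLike b β) :
    (A - B).CatalanLike (a - b) (α - β) where
  hasSum := (hA.hasSum.sub hB.hasSum).congr_fun fun n => by simp [normCoeff, sub_div]
  tendsto := (hA.tendsto.sub hB.tendsto).congr fun n => by simp [normCoeff, sub_div]

/-- Consecutive weights are asymptotically equal, so a shift costs only the factor `1 / 4` of the
normalisation, in the sum and in the asymptotic constant alike. Together with sums and differences
this suffices: the kernel and the source contain no products other than by `X`. -/
theorem X_mul (hA : A.CatalanLike a α) : (X * A).CatalanLike (a / 4) (α / 4) := by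
  have h0 : (X * A).normCoeff 0 = 0 := by simp [normCoeff]
  have h1 : ∀ n, (X * A).normCoeff (n + 1) = A.normCoeff n / 4 := fun n => by
    simp [normCoeff, coeff_succ_X_mul, pow_succ, div_div]
  constructor
  · rw [← hasSum_nat_add_iff' 1]
    simpa [h0, h1] using hA.hasSum.div_const 4
  · rw [← tendsto_add_atTop_iff_nat 1]
    simp only [h1]
    have h := (isSubexpWeight_catalanWeight.tendsto_add_div 1).mul (hA.tendsto.div_const 4)
    rw [one_mul] at h
    refine h.congr fun n => ?_
    have := (catalanWeight_pos n).ne'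
    field_simp

end PowerSeries.CatalanLike

theorem tendsto_pow_div_catalanWeight :
    Tendsto (fun n => (1 / 4 : ℝ) ^ n / catalanWeight n) atTop (𝓝 0) := by
  have h := tendsto_pow_const_mul_const_pow_of_abs_lt_one 2 (r := (1 / 4 : ℝ))
    (by rw [abs_lt]; constructor <;> norm_num)
  have h' := ((tendsto_add_atTop_iff_nat 1).mpr h).const_mul 4
  rw [mul_zero] at h'
  refine squeeze_zero (fun n => div_nonneg (by positivity) (catalanWeight_pos n).le)
    (fun n => ?_) h'
  have h1 : (1 : ℝ) ≤ ((n : ℝ) + 1) ^ 2 * catalanWeight n := by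
    simpa [catalanWeight] using monotone_sq_mul_catalanWeight (Nat.zero_le n)
  rw [div_le_iff₀ (catalanWeight_pos n)]
  push_cast
  calc (1 / 4 : ℝ) ^ n ≤ (1 / 4 : ℝ) ^ n * (((n : ℝ) + 1) ^ 2 * catalanWeight n) :=
        le_mul_of_one_le_right (by positivity) h1
    _ = _ := by rw [pow_succ]; ring

/-- The generating function of the Catalan numbers over the reals. -/
noncomputable def realCatalanSeries : PowerSeries ℝ := mk fun n => (catalan n : ℝ)

theorem realCatalanSeries_eq : realCatalanSeries = 1 + X * realCatalanSeries ^ 2 := by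
  ext n
  cases n with
  | zero => simp [realCatalanSeries]
  | succ n =>
    rw [map_add, coeff_succ_X_mul, sq, coeff_mul]
    simp [realCatalanSeries, coeff_one, catalan_succ']

theorem catalanLike_realCatalanSeries : realCatalanSeries.CatalanLike 2 1 := by
  have h : realCatalanSeries.normCoeff = catalanWeight := by
    funext n; simp [PowerSeries.normCoeff, realCatalanSeries, catalanWeight]
  constructor
  · rw [h]; exact hasSum_catalanWeight
  · simp [h, div_self (catalanWeight_pos _).ne']

theorem catalanLike_geometric : (mk (fun _ => (1 : ℝ))).CatalanLike (4 / 3) 0 := by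
  have h : (mk (fun _ => (1 : ℝ))).normCoeff = fun n => (1 / 4 : ℝ) ^ n := by
    funext n; simp [PowerSeries.normCoeff]
  constructor
  · rw [h]
    convert hasSum_geometric_of_lt_one (r := (1 / 4 : ℝ)) (by norm_num) (by norm_num) using 1
    norm_num
  · rw [h]; exact tendsto_pow_div_catalanWeight

theorem catalanLike_one : (1 : PowerSeries ℝ).CatalanLike 1 0 := by
  have h := catalanLike_geometric.sub catalanLike_geometric.X_mul
  have h1 : mk (fun _ => (1 : ℝ)) - X * mk (fun _ => (1 : ℝ)) = 1 := by
    have := PowerSeries.mk_one_mul_one_sub_eq_one ℝ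
    rw [Pi.one_def] at this
    linear_combination this
  rw [h1] at h
  norm_num at h
  exact h

/-- Asymptotics of the solution of a linear equation over power series. -/
theorem PowerSeries.tendsto_coeff_div_catalan {D G H : PowerSeries ℝ} {a b α β : ℝ}
    (hH : H.CatalanLike a α) (hG : G.CatalanLike b β) (hb : b < 1) (h : D = H + G * D)
    (hD : ∀ n, 0 ≤ coeff n D) (hG' : ∀ n, 0 ≤ coeff n G) (hG0 : coeff 0 G = 0) :
    Tendsto (fun n => coeff n D / (catalan n : ℝ)) atTop
      (𝓝 ((α + β * (a / (1 - b))) / (1 - b))) := by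
  have hr : IsRenewal D.normCoeff H.normCoeff G.normCoeff :=
    { d_nonneg := fun n => div_nonneg (hD n) (by positivity)
      g_nonneg := fun n => div_nonneg (hG' n) (by positivity)
      g_zero := by simp only [normCoeff, hG0, zero_div]
      eqn := fun n => by
        have h1 : coeff n D =
            coeff n H + ∑ k ∈ Finset.range (n + 1), coeff k G * coeff (n - k) D := by
          conv_lhs => rw [h]
          rw [map_add, coeff_mul, Finset.Nat.sum_antidiagonal_eq_sum_range_succ
            fun i j => coeff i G * coeff j D]
        rw [normCoeff, h1, add_div, Finset.sum_div]
        refine congrArg₂ _ rfl (Finset.sum_congr rfl fun k hk => ?_)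
        have h2 : (4 : ℝ) ^ n = 4 ^ k * 4 ^ (n - k) := by
          rw [← pow_add, Nat.add_sub_cancel' (Finset.mem_range_succ_iff.mp hk)]
        rw [normCoeff, normCoeff, h2, mul_div_mul_comm] }
  refine (hr.tendsto_div isSubexpWeight_catalanWeight hH.hasSum hG.hasSum hb hH.tendsto
    hG.tendsto).congr fun n => ?_
  rw [normCoeff, catalanWeight, div_div_div_cancel_right₀ (by positivity)]

/-! ### Generating functions of terms and substitutions -/

namespace LambdaUpsilon

/-- The index with `n` successors. -/
def Index.ofNat : ℕ → Index
  | 0 => .zero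
  | n + 1 => .succ (Index.ofNat n)

theorem Index.size_ofNat (n : ℕ) : (Index.ofNat n).size = n + 1 := by
  induction n with
  | zero => rfl
  | succ n ih => rw [Index.ofNat, Index.size, ih]

theorem Index.eq_ofNat {i : Index} {n : ℕ} (h : i.size = n + 1) : i = Index.ofNat n := by
  induction n generalizing i with
  | zero =>
    cases i with
    | zero => rfl
    | succ i => exact absurd h (by have := i.size_pos; rw [Index.size]; omega)
  | succ n ih =>
    cases i with
    | zero => simp [Index.size] at h
    | succ i => rw [Index.ofNat, ← ih (i := i) (by simpa [Index.size] using h)]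

theorem Subst.size_pos (s : Subst) : 0 < s.size := by
  cases s <;> simp [Subst.size]

/-- The terms of size `n`. -/
noncomputable def terms (n : ℕ) : Finset Term := (finite_size_eq n).toFinset

/-- The substitutions of size `n`. -/
noncomputable def substs (n : ℕ) : Finset Subst :=
  ((finite_size_le n).2.subset fun _ h => le_of_eq h : {s : Subst | s.size = n}.Finite).toFinset

@[simp] theorem mem_terms {n : ℕ} {t : Term} : t ∈ terms n ↔ t.size = n := by simp [terms]

@[simp] theorem mem_substs {n : ℕ} {s : Subst} : s ∈ substs n ↔ s.size = n := by simp [substs]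

theorem terms_zero : terms 0 = ∅ := by
  ext t
  simp [t.size_pos.ne']

theorem substs_zero : substs 0 = ∅ := by
  ext s
  simp [s.size_pos.ne']

section Sums

variable {M : Type*} [AddCommMonoid M]

/-- An arbitrary summand `f` lets one decomposition serve both counting (`f = 1`) and the
unsuspended total. -/
theorem sum_terms_succ (f : Term → M) (n : ℕ) :
    ∑ t ∈ terms (n + 1), f t = f (.idx (.ofNat n)) + ∑ a ∈ terms n, f (.lam a) +
      ∑ p ∈ Finset.HasAntidiagonal.antidiagonal n, ∑ a ∈ terms p.1, ∑ b ∈ terms p.2, f (.app a b) +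
      ∑ p ∈ Finset.HasAntidiagonal.antidiagonal n, ∑ a ∈ terms p.1, ∑ s ∈ substs p.2, f (.closure a s) := by
  let P := (Finset.HasAntidiagonal.antidiagonal n).sigma fun p => terms p.1 ×ˢ terms p.2
  let Q := (Finset.HasAntidiagonal.antidiagonal n).sigma fun p => terms p.1 ×ˢ substs p.2
  let e : ((Unit ⊕ Term) ⊕ (Σ _ : ℕ × ℕ, Term × Term)) ⊕ (Σ _ : ℕ × ℕ, Term × Subst) → Term :=
    Sum.elim (Sum.elim (Sum.elim (fun _ => .idx (.ofNat n)) .lam) fun x => .app x.2.1 x.2.2)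
      fun x => .closure x.2.1 x.2.2
  have h : ∑ x ∈ ((({()} : Finset Unit).disjSum (terms n)).disjSum P).disjSum Q, f (e x) =
      ∑ t ∈ terms (n + 1), f t := by
    refine Finset.sum_nbij e ?_ ?_ ?_ fun _ _ => rfl
    · rintro (((_ | a) | ⟨p, a, b⟩) | ⟨p, a, s⟩) hx <;>
        simp [P, Q, e, Term.size, Index.size_ofNat] at hx ⊢ <;> omega
    · rintro (((_ | a) | ⟨p, a, b⟩) | ⟨p, a, s⟩) hx (((_ | a') | ⟨p', a', b'⟩) | ⟨p', a', s'⟩) hy <;>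
        simp [P, Q, e] at hx hy ⊢
      · rintro rfl rfl
        exact ⟨Prod.ext (hx.2.1.symm.trans hy.2.1) (hx.2.2.symm.trans hy.2.2), rfl, rfl⟩
      · rintro rfl rfl
        exact ⟨Prod.ext (hx.2.1.symm.trans hy.2.1) (hx.2.2.symm.trans hy.2.2), rfl, rfl⟩
    · rintro (i | a | ⟨a, b⟩ | ⟨a, s⟩) ht <;> simp [Term.size] at ht
      · exact ⟨.inl (.inl (.inl ())), by simp, by rw [Index.eq_ofNat ht]; rfl⟩
      · exact ⟨.inl (.inl (.inr a)), by simpa using ht, rfl⟩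
      · exact ⟨.inl (.inr ⟨(a.size, b.size), a, b⟩), by simpa [P] using ht, rfl⟩
      · exact ⟨.inr ⟨(a.size, s.size), a, s⟩, by simpa [Q] using ht, rfl⟩
  rw [← h, Finset.sum_disjSum, Finset.sum_disjSum, Finset.sum_disjSum, Finset.sum_sigma,
    Finset.sum_sigma]
  simp [e, Finset.sum_product]

theorem sum_substs_succ (f : Subst → M) (n : ℕ) :
    ∑ s ∈ substs (n + 1), f s = ∑ a ∈ terms n, f (.slash a) + ∑ s ∈ substs n, f (.lift s) +
      if n = 0 then f .shift else 0 := by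
  let e : (Term ⊕ Subst) ⊕ Unit → Subst :=
    Sum.elim (Sum.elim .slash .lift) fun _ => .shift
  have h : ∑ x ∈ ((terms n).disjSum (substs n)).disjSum
      (({()} : Finset Unit).filter fun _ => n = 0), f (e x) = ∑ s ∈ substs (n + 1), f s := by
    refine Finset.sum_nbij e ?_ ?_ ?_ fun _ _ => rfl
    · rintro ((a | s) | _) hx <;>
        simp only [Finset.mem_disjSum, Finset.mem_filter] at hx <;> simp [e, Subst.size] at hx ⊢ <;>
        assumption
    · rintro ((a | s) | _) hx ((a' | s') | _) hy <;> simp [e]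
    · rintro (a | s | _) hs <;> simp [Subst.size] at hs
      · exact ⟨.inl (.inl a), by simpa using hs, rfl⟩
      · exact ⟨.inl (.inr s), by simpa using hs, rfl⟩
      · exact ⟨.inr (), by simp [hs], rfl⟩
  rw [← h, Finset.sum_disjSum, Finset.sum_disjSum]
  rw [Finset.sum_filter]
  simp [e]

end Sums

open PowerSeries

/-- The generating function of terms by size. -/
noncomputable def termSeries : PowerSeries ℝ := mk fun n => ((terms n).card : ℝ)

/-- The generating function of substitutions by size. -/
noncomputable def substSeries : PowerSeries ℝ := mk fun n => ((substs n).card : ℝ)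

/-- The generating function of the total number of unsuspended constructors in terms of given
size. -/
noncomputable def unsuspendedSeries : PowerSeries ℝ :=
  mk fun n => ∑ t ∈ terms n, (t.unsuspended : ℝ)

/-- The geometric series. -/
local notation "Γ" => (mk fun _ => (1 : ℝ))

theorem geometric_eq : Γ = 1 + X * Γ := by
  ext n
  cases n <;> simp [coeff_succ_X_mul, coeff_one]

theorem termSeries_eq : termSeries =
    X * Γ + X * termSeries + X * (termSeries * termSeries) + X * (termSeries * substSeries) := by
  ext n
  cases n with
  | zero => simp [termSeries, terms_zero]
  | succ n =>
    have h := sum_terms_succ (fun _ => (1 : ℝ)) n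
    simp only [map_add, coeff_succ_X_mul]
    simp only [coeff_mul, termSeries, substSeries, coeff_mk]
    simpa using h

theorem substSeries_eq : substSeries = X * termSeries + X * substSeries + X := by
  ext n
  cases n with
  | zero => simp [substSeries, substs_zero]
  | succ n =>
    have h := sum_substs_succ (fun _ => (1 : ℝ)) n
    simp only [map_add, coeff_succ_X_mul]
    simp only [termSeries, substSeries, coeff_mk, coeff_X]
    simpa using h

theorem unsuspendedSeries_eq : unsuspendedSeries =
    X * (Γ * Γ) + X * termSeries + X * unsuspendedSeries + X * (termSeries * termSeries) +
      (X * (unsuspendedSeries * termSeries) + X * (termSeries * unsuspendedSeries)) + X * (termSeries * substSeries) +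
      X * (unsuspendedSeries * substSeries) := by
  ext n
  cases n with
  | zero => simp [unsuspendedSeries, terms_zero]
  | succ n =>
    have h := sum_terms_succ (fun t => (t.unsuspended : ℝ)) n
    simp only [Term.unsuspended, Nat.cast_add, Nat.cast_one, Index.size_ofNat,
      Finset.sum_add_distrib, Finset.sum_const, nsmul_eq_mul, mul_one, ← Finset.mul_sum] at h
    simp only [map_add, coeff_succ_X_mul]
    simp only [coeff_mul, unsuspendedSeries, termSeries, substSeries,
      coeff_mk, h, mul_one, Finset.sum_const, nsmul_eq_mul, Finset.Nat.card_antidiagonal]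
    simp only [mul_comm, Nat.cast_add, Nat.cast_one]
    ring

/-- Multiplying the equation of `T` by `1 - X` and using `(1 - X) S = X T + X` leaves `T = X (1 + T)
^ 2`. Thus `1 + T` and `C` both solve `y = 1 + X y ^ 2`. Their difference is killed by a series with
constant term `1`, hence vanishes. -/
theorem one_add_termSeries : 1 + termSeries = realCatalanSeries := by
  have h1 : termSeries = X * (1 + termSeries) ^ 2 := by
    linear_combination (1 - X) * termSeries_eq + X * termSeries * substSeries_eq + X * geometric_eq
  have h2 : (1 + termSeries - realCatalanSeries) *
      (1 - X * (1 + termSeries + realCatalanSeries)) = 0 := by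
    linear_combination h1 - realCatalanSeries_eq
  refine sub_eq_zero.mp ((mul_eq_zero.mp h2).resolve_right fun h => ?_)
  simpa using congrArg constantCoeff h

/-- The kernel of the renewal equation satisfied by `unsuspendedSeries`. -/
noncomputable def unsuspendedKernel : PowerSeries ℝ :=
  -- The unsimplified form lets `CatalanLike.X_mul`, `add` and `sub` apply summand by summand.
  X * (X * 1) + (X * realCatalanSeries + X * realCatalanSeries) - X * (X * realCatalanSeries)

/-- The inhomogeneity of the renewal equation satisfied by `unsuspendedSeries`. -/
noncomputable def unsuspendedSource : PowerSeries ℝ :=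
  (realCatalanSeries - 1) - X * (realCatalanSeries - 1) + X * (X * Γ)

/-- The `U`-free part of the equation of `U` is `T + X Γ (Γ - 1) = T + X ^ 2 Γ ^ 2`, by the equation
of `T`. Multiplying by `1 - X` eliminates `S` and turns `X ^ 2 Γ ^ 2` into `X ^ 2 Γ`. -/
theorem unsuspendedSeries_renewal :
    unsuspendedSeries = unsuspendedSource + unsuspendedKernel * unsuspendedSeries := by
  rw [unsuspendedSource, unsuspendedKernel, ← one_add_termSeries]
  linear_combination (1 - X) * unsuspendedSeries_eq + X * unsuspendedSeries * substSeries_eq -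
    (1 - X) * termSeries_eq + X * Γ * geometric_eq

end LambdaUpsilon

-- The constants of the renewal equation and the limit `316 / 3`

namespace LambdaUpsilon

open PowerSeries

theorem card_terms {n : ℕ} (hn : 1 ≤ n) : (terms n).card = catalan n := by
  have h := congrArg (coeff n) one_add_termSeries
  simp only [map_add, coeff_one, termSeries, realCatalanSeries, coeff_mk,
    if_neg (Nat.one_le_iff_ne_zero.mp hn), zero_add] at h
  exact_mod_cast h

/-- The only negative contribution, from `X ^ 2 C`, is absorbed by `2 X C` because the Catalan
numbers are nondecreasing. -/
theorem coeff_unsuspendedKernel_nonneg (n : ℕ) : 0 ≤ coeff n unsuspendedKernel := by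
  have hmono : ∀ n, (catalan n : ℝ) ≤ catalan (n + 1) := fun n => by
    have h1 := catalan_succ_mul n
    have h2 : catalan n ≤ catalan (n + 1) := by
      by_contra! h
      nlinarith
    exact_mod_cast h2
  rcases n with _ | _ | n
  · simp [unsuspendedKernel]
  · simp [unsuspendedKernel, coeff_succ_X_mul, realCatalanSeries]
  · have h1 := hmono n
    have h2 : (0 : ℝ) ≤ catalan (n + 1) := Nat.cast_nonneg _
    have h3 : (0 : ℝ) ≤ coeff n (1 : PowerSeries ℝ) := by
      rw [coeff_one]; split_ifs <;> norm_num
    simp only [unsuspendedKernel, map_add, map_sub, coeff_succ_X_mul, realCatalanSeries, coeff_mk]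
    linarith

theorem catalanLike_unsuspendedKernel : unsuspendedKernel.CatalanLike (15 / 16) (7 / 16) := by
  have hC := catalanLike_realCatalanSeries
  convert (catalanLike_one.X_mul.X_mul.add (hC.X_mul.add hC.X_mul)).sub hC.X_mul.X_mul using 1
  · rfl
  all_goals norm_num

theorem catalanLike_unsuspendedSource : unsuspendedSource.CatalanLike (5 / 6) (3 / 4) := by
  have hT := catalanLike_realCatalanSeries.sub catalanLike_one
  convert (hT.sub hT.X_mul).add catalanLike_geometric.X_mul.X_mul using 1
  · rfl
  all_goals norm_num

theorem tendsto_sum_unsuspended_div_catalan :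
    Tendsto (fun n => (∑ t ∈ terms n, (t.unsuspended : ℝ)) / catalan n) atTop (𝓝 (316 / 3)) := by
  have h := tendsto_coeff_div_catalan catalanLike_unsuspendedSource catalanLike_unsuspendedKernel
    (by norm_num) unsuspendedSeries_renewal
    (fun n => by
      rw [unsuspendedSeries, coeff_mk]
      exact Finset.sum_nonneg fun t _ => Nat.cast_nonneg _)
    coeff_unsuspendedKernel_nonneg (by simp [unsuspendedKernel])
  norm_num [unsuspendedSeries] at h
  exact h

/-! ### Expectations under the uniform law -/

theorem ae_uniformTerm (n : ℕ) : ∀ᵐ t ∂uniformTerm n, t.size = n :=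
  ae_cond_mem (MeasurableSet.of_discrete)

theorem uniformTerm_real_singleton {n : ℕ} {t : Term} (ht : t.size = n) :
    (uniformTerm n).real {t} = ((terms n).card : ℝ)⁻¹ := by
  have h1 : {t : Term | t.size = n} ∩ {t} = {t} := by
    rw [Set.inter_eq_right, Set.singleton_subset_iff]; exact ht
  have h2 : Measure.count {t : Term | t.size = n} = ((terms n).card : ENNReal) := by
    rw [Measure.count_apply_finite _ (finite_size_eq n)]; rfl
  rw [Measure.real, uniformTerm, uniformOn, cond_apply MeasurableSet.of_discrete, h1,
    Measure.count_singleton, mul_one, h2, ENNReal.toReal_inv, ENNReal.toReal_natCast]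

theorem integrable_uniformTerm {n : ℕ} (hn : 1 ≤ n) (f : Term → ℝ) :
    Integrable f (uniformTerm n) := by
  have := isProbabilityMeasure_uniformTerm hn
  refine Integrable.of_bound (C := ∑ t ∈ terms n, ‖f t‖)
    (Measurable.of_discrete).aestronglyMeasurable ?_
  filter_upwards [ae_uniformTerm n] with t ht
  exact Finset.single_le_sum (f := fun t => ‖f t‖) (fun t _ => norm_nonneg _) (mem_terms.mpr ht)

theorem integral_uniformTerm {n : ℕ} (hn : 1 ≤ n) (f : Term → ℝ) :
    ∫ t, f t ∂uniformTerm n = (∑ t ∈ terms n, f t) / (terms n).card := by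
  have := isProbabilityMeasure_uniformTerm hn
  have h1 : (uniformTerm n).restrict (terms n) = uniformTerm n := by
    refine Measure.restrict_eq_self_of_ae_mem ?_
    filter_upwards [ae_uniformTerm n] with t ht
    exact mem_terms.mpr ht
  rw [← h1, setIntegral_finset _ ((integrable_uniformTerm hn f).integrableOn), Finset.sum_div]
  refine Finset.sum_congr rfl fun t ht => ?_
  rw [uniformTerm_real_singleton (mem_terms.mp ht), smul_eq_mul, div_eq_inv_mul]

theorem tendsto_integral_unsuspended :
    Tendsto (fun n : ℕ => ∫ t, (t.unsuspended : ℝ) ∂uniformTerm n) atTop (𝓝 (316 / 3)) := by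
  refine tendsto_sum_unsuspended_div_catalan.congr' ?_
  filter_upwards [eventually_ge_atTop 1] with n hn
  rw [integral_uniformTerm hn, card_terms hn]

theorem suspended_div_eq {t : Term} {n : ℕ} (hn : 1 ≤ n) (ht : t.size = n) :
    (t.suspended : ℝ) / n = 1 - (t.unsuspended : ℝ) / n := by
  have h : (t.unsuspended : ℝ) + t.suspended = n := by
    exact_mod_cast t.unsuspended_add_suspended.trans ht
  have hn' : (n : ℝ) ≠ 0 := by exact_mod_cast Nat.one_le_iff_ne_zero.mp hn
  field_simp
  linarith

theorem integral_suspended_div {n : ℕ} (hn : 1 ≤ n) :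
    ∫ t, (t.suspended : ℝ) / n ∂uniformTerm n =
      1 - (∫ t, (t.unsuspended : ℝ) ∂uniformTerm n) / n := by
  have := isProbabilityMeasure_uniformTerm hn
  have h : (fun t : Term => (t.suspended : ℝ) / n) =ᵐ[uniformTerm n]
      fun t => 1 - (t.unsuspended : ℝ) / n := by
    filter_upwards [ae_uniformTerm n] with t ht using suspended_div_eq hn ht
  rw [integral_congr_ae h, integral_sub (integrable_const _) (integrable_uniformTerm hn _),
    integral_div]
  simp

theorem tendsto_integral_unsuspended_div :
    Tendsto (fun n : ℕ => (∫ t, (t.unsuspended : ℝ) ∂uniformTerm n) / n) atTop (𝓝 0) :=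
  tendsto_integral_unsuspended.div_atTop tendsto_natCast_atTop_atTop

/-- Markov's inequality: if the suspended part is below `(1 - ε) * n`, the unsuspended part exceeds
`ε * n`. -/
theorem one_sub_le_uniformTerm_real {n : ℕ} (hn : 1 ≤ n) {ε : ℝ} (hε : 0 < ε) :
    1 - (∫ t, (t.unsuspended : ℝ) ∂uniformTerm n) / n / ε ≤
      (uniformTerm n).real {t | (1 - ε) * (n : ℝ) ≤ (t.suspended : ℝ)} := by
  have := isProbabilityMeasure_uniformTerm hn
  have hn' : (0 : ℝ) < n := by exact_mod_cast hn
  have h1 := mul_meas_ge_le_integral_of_nonneg (μ := uniformTerm n)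
    (ae_of_all _ fun t : Term => Nat.cast_nonneg (α := ℝ) t.unsuspended)
    (integrable_uniformTerm hn _) (ε * n)
  have h2 : (uniformTerm n).real {t | (1 - ε) * (n : ℝ) ≤ (t.suspended : ℝ)}ᶜ ≤
      (uniformTerm n).real {t | ε * (n : ℝ) ≤ (t.unsuspended : ℝ)} := by
    refine ENNReal.toReal_mono (measure_ne_top _ _) (measure_mono_ae ?_)
    filter_upwards [ae_uniformTerm n] with t ht hts
    have h3 : (t.unsuspended : ℝ) + t.suspended = n := by
      exact_mod_cast t.unsuspended_add_suspended.trans ht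
    have h4 : (t.suspended : ℝ) < (1 - ε) * n := not_le.mp hts
    change ε * (n : ℝ) ≤ t.unsuspended
    linarith
  rw [probReal_compl_eq_one_sub MeasurableSet.of_discrete] at h2
  have h3 : (uniformTerm n).real {t | ε * (n : ℝ) ≤ (t.unsuspended : ℝ)} ≤
      (∫ t, (t.unsuspended : ℝ) ∂uniformTerm n) / n / ε := by
    rw [div_div, le_div_iff₀ (by positivity)]
    calc _ = ε * n * (uniformTerm n).real {t | ε * (n : ℝ) ≤ (t.unsuspended : ℝ)} := by ring
      _ ≤ _ := h1
  linarith

end LambdaUpsilon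

theorem mainTheorem4 :
    Tendsto (fun n : ℕ => ∫ t, (t.unsuspended : ℝ) ∂(LambdaUpsilon.uniformTerm n))
        atTop (𝓝 (316 / 3)) ∧
      Tendsto (fun n : ℕ => ∫ t, (t.suspended : ℝ) / (n : ℝ) ∂(LambdaUpsilon.uniformTerm n))
        atTop (𝓝 1) ∧
      ∀ ε : ℝ, 0 < ε →
        Tendsto (fun n : ℕ => (LambdaUpsilon.uniformTerm n).real
          {t | (1 - ε) * (n : ℝ) ≤ (t.suspended : ℝ)}) atTop (𝓝 1) := by
  refine ⟨LambdaUpsilon.tendsto_integral_unsuspended, ?_, fun ε hε => ?_⟩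
  · have h := LambdaUpsilon.tendsto_integral_unsuspended_div.const_sub 1
    rw [sub_zero] at h
    refine h.congr' ?_
    filter_upwards [eventually_ge_atTop 1] with n hn using (LambdaUpsilon.integral_suspended_div hn).symm
  · have h := (LambdaUpsilon.tendsto_integral_unsuspended_div.div_const ε).const_sub 1
    rw [zero_div, sub_zero] at h
    refine tendsto_of_tendsto_of_tendsto_of_le_of_le' h tendsto_const_nhds ?_ ?_
    · filter_upwards [eventually_ge_atTop 1] with n hn using LambdaUpsilon.one_sub_le_uniformTerm_real hn hε
    · filter_upwards [eventually_ge_atTop 1] with n hn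
      have := LambdaUpsilon.isProbabilityMeasure_uniformTerm hn
      exact measureReal_le_one
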